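/- Conventions. Real algebraic varieties are taken, up to isomorphism, as algebraic sets $X\subset\mathbb{R}^m$, $Y\subset\mathbb{R}^n$, equipped with the Euclidean topology. A map $X\to Y$ is regular if each of its components can be written as $P/Q$ on $X$, with $P,Q$ real polynomials and $Q$ without zeros on $X$. A vector bundle $p:E\to Y$ is algebraic if, up to isomorphism, it is an algebraic vector subbundle of a product bundle $Y\times\mathbb{R}^N$, that is, Zariski locally on $Y$ the fibers $E_y\subset\mathbb{R}^N$ have a basis consisting of regular sections. "Nonsingular" means nonsingular at every point; the local dimension is allowed to vary. A nonsingular real algebraic variety $Y$ is called quasi-malleable if there exist an algebraic vector bundle $p:E\to Y$ and, for every relatively compact open subset $V$ of $Y$, a regular map $s_V:E\to Y$ and a smooth (that is, $\mathcal{C}^\infty$) map $\tau_V:V\to E$ such that for all $y\in V$ one has $p(\tau_V(y))=y$ and $s_V(\tau_V(y))=y$, and the map $E_y\to Y$, $v\mapsto s_V(v+\tau_V(y))$, is a submersion at $0_y\in E_y$. Theorem 1.12. Let $Y$ be a quasi-malleable nonsingular real algebraic variety. Let $X$ be a (possibly singular) real algebraic variety, and let $f:D\to Y$ be a continuous map defined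 on an arbitrary subset $D$ of $X$. Assume that there exists a regular map $f_0:X\to Y$ whose restriction $f_0|_D$ is homotopic to $f$. Then $f$ can be approximated in the compact-open topology by regular maps from $X$ to $Y$: for every open neighborhood $\mathcal{U}$ of $f$ in the space $\mathcal{C}(D,Y)$ of continuous maps from $D$ to $Y$, endowed with the compact-open topology, there exists a regular map $g:X\to Y$ with $g|_D\in\mathcal{U}$. -/

import Mathlib

open scoped ContDiff

/-- A real algebraic variety. Every real algebraic variety (a ringed space isomorphic to a Zariski
locally closed subset of a real projective space) is affine, so it is presented as an algebraic set,
the common zero set in `ℝ^ι` of a family of real polynomials. Its points carry the Euclidean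
topology. -/
structure RealAlgVariety (ι : Type) where
  /-- the set of (real) points -/
  carrier : Set (ι → ℝ)
  isAlgebraic : ∃ S : Set (MvPolynomial ι ℝ),
    carrier = {x | ∀ P ∈ S, MvPolynomial.eval x P = 0}

namespace RealAlgVariety

instance {ι : Type} : CoeSort (RealAlgVariety ι) Type :=
  ⟨fun X => X.carrier⟩

/-- Zariski open subsets of a real algebraic variety: complements of zero sets of polynomials. -/
def IsZariskiOpen {ι : Type} (X : RealAlgVariety ι) (U : Set X) : Prop :=
  ∃ S : Set (MvPolynomial ι ℝ), U = {x | ∃ P ∈ S, MvPolynomial.eval x.1 P ≠ 0}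

/-- `φ` is a regular function on the (Zariski open) subset `U` of `X`: on `U` it is a quotient of
two polynomials, the denominator having no zero in `U`. Only the values of `φ` on `U` matter. -/
def IsRegularOn {ι : Type} (X : RealAlgVariety ι) (U : Set X) (φ : X → ℝ) : Prop :=
  ∃ P Q : MvPolynomial ι ℝ, ∀ x ∈ U,
    MvPolynomial.eval x.1 Q ≠ 0 ∧ φ x = MvPolynomial.eval x.1 P / MvPolynomial.eval x.1 Q

/-- Nonsingularity, by the Jacobian criterion: near each of its points `y`, in the Zariski topology,
`Y` is the zero set of finitely many polynomials which vanish on `Y` and whose gradients at `y` are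
linearly independent. -/
def IsNonsingular {ι : Type} (Y : RealAlgVariety ι) : Prop :=
  ∀ y : Y, ∃ (c : ℕ) (P : Fin c → MvPolynomial ι ℝ),
    (∀ j, ∀ x : Y, MvPolynomial.eval x.1 (P j) = 0) ∧
    LinearIndependent ℝ
      (fun (j : Fin c) (i : ι) => MvPolynomial.eval y.1 (MvPolynomial.pderiv i (P j))) ∧
    ∃ Q : MvPolynomial ι ℝ, MvPolynomial.eval y.1 Q ≠ 0 ∧
      ∀ x : ι → ℝ, MvPolynomial.eval x Q ≠ 0 → (∀ j, MvPolynomial.eval x (P j) = 0) →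
        x ∈ Y.carrier

/-- The tangent space `T_y Y`, as a linear subspace of the ambient space: the vectors annihilated
by the differential at `y` of every polynomial vanishing on `Y`. -/
def tangentSpace {ι : Type} [Fintype ι] (Y : RealAlgVariety ι) (y : Y) : Submodule ℝ (ι → ℝ) where
  carrier := {w | ∀ P : MvPolynomial ι ℝ, (∀ x : Y, MvPolynomial.eval x.1 P = 0) →
    ∑ i, MvPolynomial.eval y.1 (MvPolynomial.pderiv i P) * w i = 0}
  zero_mem' := by intro P _; simp
  add_mem' := by
    intro a b ha hb P hP
    simp only [Pi.add_apply, mul_add, Finset.sum_add_distrib, ha P hP, hb P hP, add_zero]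
  smul_mem' := by
    intro c a ha P hP
    simp only [Pi.smul_apply, smul_eq_mul, mul_left_comm _ c, ← Finset.mul_sum, ha P hP, mul_zero]

/-- A map from an open subset `V` of the (nonsingular) variety `Y` to `ℝ^κ` is smooth if locally it
extends to a smooth map on an open subset of the ambient space of `Y`. -/
def IsSmooth {ι κ : Type} [Fintype ι] [Fintype κ] {Y : RealAlgVariety ι} (V : Set Y)
    (g : V → (κ → ℝ)) : Prop :=
  ∀ y : V, ∃ (O : Set (ι → ℝ)) (G : (ι → ℝ) → (κ → ℝ)), IsOpen O ∧ y.1.1 ∈ O ∧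
    ContDiffOn ℝ ∞ G O ∧ ∀ z : V, z.1.1 ∈ O → G z.1.1 = g z

/-- The relatively compact open subsets of `Y`, for the Euclidean topology. -/
abbrev RelCompactOpen {ι : Type} (Y : RealAlgVariety ι) : Type :=
  {V : Set Y // IsOpen V ∧ IsCompact (closure V)}

end RealAlgVariety

/-- Regular maps between real algebraic varieties: all the components are regular functions. -/
structure RegularMap {ι κ : Type} (X : RealAlgVariety ι) (Y : RealAlgVariety κ) where
  /-- the underlying map -/
  toFun : X → Y
  isRegular : ∀ j : κ, X.IsRegularOn Set.univ (fun x => (toFun x).1 j)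

namespace RegularMap

theorem continuous_toFun {ι κ : Type} {X : RealAlgVariety ι} {Y : RealAlgVariety κ}
    (f : RegularMap X Y) : Continuous f.toFun := by
  refine Continuous.subtype_mk (f := fun x => (f.toFun x).1) (continuous_pi fun j => ?_) _
  obtain ⟨P, Q, h⟩ := f.isRegular j
  have he : (fun x : X => (f.toFun x).1 j)
      = fun x : X => MvPolynomial.eval x.1 P / MvPolynomial.eval x.1 Q :=
    funext fun x => (h x trivial).2
  rw [he]
  exact ((MvPolynomial.continuous_eval P).comp continuous_subtype_val).div
    ((MvPolynomial.continuous_eval Q).comp continuous_subtype_val) fun x => (h x trivial).1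

/-- A regular map, as a continuous map for the Euclidean topologies. -/
def toContinuousMap {ι κ : Type} {X : RealAlgVariety ι} {Y : RealAlgVariety κ}
    (f : RegularMap X Y) : C(X, Y) :=
  ⟨f.toFun, f.continuous_toFun⟩

end RegularMap

/-- An algebraic vector bundle `E` over `Y`. By definition such a bundle is, up to isomorphism, an
algebraic vector subbundle of a product bundle `Y × ℝ^N`. So it is presented by its fibers
`E_y ⊆ ℝ^N`, which are required to have, Zariski locally on `Y`, a basis depending regularly on
`y`. The rank may vary with `y`. -/
structure AlgVectorBundle {ι : Type} (Y : RealAlgVariety ι) where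
  /-- the rank of the product bundle that contains `E` -/
  N : ℕ
  /-- the fiber `E_y` -/
  fiber : Y → Submodule ℝ (Fin N → ℝ)
  /-- local triviality -/
  locallyTrivial : ∀ y₀ : Y, ∃ U : Set Y, Y.IsZariskiOpen U ∧ y₀ ∈ U ∧
    ∃ (k : ℕ) (e : Fin k → Y → (Fin N → ℝ)),
      (∀ j i, Y.IsRegularOn U (fun y => e j y i)) ∧
      ∀ y ∈ U, LinearIndependent ℝ (fun j => e j y) ∧
        Submodule.span ℝ (Set.range fun j => e j y) = fiber y
  /-- the total space is a real algebraic variety -/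
  isAlgebraic_total : ∃ S : Set (MvPolynomial (ι ⊕ Fin N) ℝ),
    {e : ι ⊕ Fin N → ℝ | ∃ (y : Y) (v : fiber y), e = Sum.elim y.1 v.1}
      = {e | ∀ P ∈ S, MvPolynomial.eval e P = 0}

namespace AlgVectorBundle

/-- The total space of `E`, the set of all `(y, v)` with `y ∈ Y` and `v ∈ E_y`. -/
def total {ι : Type} {Y : RealAlgVariety ι} (E : AlgVectorBundle Y) :
    RealAlgVariety (ι ⊕ Fin E.N) :=
  ⟨{e | ∃ (y : Y) (v : E.fiber y), e = Sum.elim y.1 v.1}, E.isAlgebraic_total⟩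

/-- The point `(y, v)` of the total space, for `v ∈ E_y`. -/
def point {ι : Type} {Y : RealAlgVariety ι} (E : AlgVectorBundle Y) (y : Y) (v : E.fiber y) :
    E.total :=
  ⟨Sum.elim y.1 v.1, y, v, rfl⟩

end AlgVectorBundle

/-- A quasi-spray for `Y`: an algebraic vector bundle `p : E → Y` and, for every relatively compact
open subset `V` of `Y`, a regular map `s V : E → Y` and a smooth map `τ V : V → E` with
`p (τ V y) = y` (so `τ V y` is given as an element of the fiber `E_y`) and `s V (τ V y) = y`. -/
structure QuasiSpray {ι : Type} [Fintype ι] (Y : RealAlgVariety ι) where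
  /-- the vector bundle -/
  E : AlgVectorBundle Y
  /-- the regular maps `E → Y` -/
  s : Y.RelCompactOpen → RegularMap E.total Y
  /-- the smooth sections of `E` over `V` -/
  τ : (V : Y.RelCompactOpen) → (y : V.1) → E.fiber y.1
  smooth_τ : ∀ V : Y.RelCompactOpen,
    RealAlgVariety.IsSmooth V.1 (fun y => (E.point y.1 (τ V y)).1)
  s_τ : ∀ (V : Y.RelCompactOpen) (y : V.1), (s V).toFun (E.point y.1 (τ V y)) = y.1

/-- A quasi-spray is dominating if for all `V` and all `y ∈ V` the map `E_y → Y`,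
`v ↦ s V (v + τ V y)`, is a submersion at `0`: its derivative there, a linear map from `E_y` to the
ambient space of `Y`, has image `T_y Y`. -/
def QuasiSpray.IsDominating {ι : Type} [Fintype ι] {Y : RealAlgVariety ι} (q : QuasiSpray Y) :
    Prop :=
  ∀ (V : Y.RelCompactOpen) (y : V.1), ∃ L : q.E.fiber y.1 →L[ℝ] (ι → ℝ),
    HasFDerivAt
      (fun v : q.E.fiber y.1 => ((q.s V).toFun (q.E.point y.1 (v + q.τ V y))).1) L 0 ∧
    LinearMap.range L.toLinearMap = Y.tangentSpace y.1

/-- `Y` is quasi-malleable if it admits a dominating quasi-spray. -/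
def RealAlgVariety.IsQuasiMalleable {ι : Type} [Fintype ι] (Y : RealAlgVariety ι) : Prop :=
  ∃ q : QuasiSpray Y, q.IsDominating

/-- `f : D → Y` can be approximated in the compact-open topology by regular maps from `X` to `Y`:
every open neighborhood of `f` in `C(D, Y)` contains the restriction to `D` of a regular map. -/
def ApproximableByRegularMaps {ι κ : Type} (X : RealAlgVariety ι) (Y : RealAlgVariety κ)
    (D : Set X) (f : C(D, Y)) : Prop :=
  ∀ 𝒰 : Set C(D, Y), IsOpen 𝒰 → f ∈ 𝒰 →
    ∃ g : RegularMap X Y, g.toContinuousMap.restrict D ∈ 𝒰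

/-!
Approximation in the compact-open topology is uniform approximation on compact sets `Z ⊆ D`. Along
the path of maps `Z → Y` given by the homotopy, being a uniform limit of regular maps `X → Y` is a
closed condition, and it holds at the start; by connectedness of the interval it suffices that it is
also open (`RealAlgVariety.IsQuasiMalleable.mem_closure_range_of_path`). This amounts to the
following local statement: a continuous `h : Z → Y` which is close enough to a regular map `g` is a
uniform limit of regular maps.

It follows by iterating a Newton step (`RealAlgVariety.IsQuasiMalleable.exists_newton_step`), which
replaces `g` by a regular map `g'` twice as close to `h`. Let `V` be a large ball in `Y`, and let
`A y : E_y → T_y Y` be the derivative at `0` of `v ↦ s V (v + τ V y)`. It is surjective, and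
`h x - g x` is tangent to `Y` at `g x` up to a small relative error, so that there is a small
`w x ∈ E_{g x}` with `A (g x) (w x)` close to `h x - g x`; then `s V (τ V (g x) + w x)` is close to
`h x`. To obtain a regular map it remains to choose `τ V (g x) + w x` as a regular section along
`g`. The bundle `E` is generated by finitely many polynomial sections
(`AlgVectorBundle.exists_frameMap`), and the vectors of coefficients that are good enough form a
convex set which varies in an open way with `x`. Hence a partition of unity provides continuous
coefficients, and the Stone–Weierstrass theorem polynomial ones.

No charts of `Y` are involved: the approximate tangency of `h x - g x` is
`RealAlgVariety.eventually_norm_map_sub_le`, which comes from the polynomials vanishing on `Y`.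
-/

open Filter Topology

/-! ### Differential calculus of polynomials -/

namespace MvPolynomial

theorem hasStrictFDerivAt_eval {ι : Type*} [Fintype ι] (P : MvPolynomial ι ℝ) (x : ι → ℝ) :
    HasStrictFDerivAt (fun z : ι → ℝ => eval z P)
      (∑ i, eval x (pderiv i P) • ContinuousLinearMap.proj (R := ℝ) (φ := fun _ : ι => ℝ) i) x := by
  classical
  induction P using MvPolynomial.induction_on with
  | C a =>
    simpa using hasStrictFDerivAt_const (𝕜 := ℝ) a x
  | add p q hp hq =>
    refine (hp.add hq).congr_fderiv ?_ |>.congr_of_eventuallyEq (.of_forall fun z => ?_)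
    · simp [add_smul, Finset.sum_add_distrib]
    · simp
  | mul_X p j hp =>
    have hj : HasStrictFDerivAt (fun z : ι → ℝ => z j)
        (ContinuousLinearMap.proj (R := ℝ) (φ := fun _ : ι => ℝ) j) x :=
      (ContinuousLinearMap.proj (R := ℝ) (φ := fun _ : ι => ℝ) j).hasStrictFDerivAt
    have h := hp.mul hj
    simp only [map_mul, eval_X]
    refine h.congr_fderiv ?_
    ext v
    simp [pderiv_X, Pi.single_apply, Derivation.leibniz, add_mul, Finset.sum_add_distrib,
      Finset.mul_sum, mul_assoc, apply_ite (eval x), ite_mul]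

theorem contDiff_eval {ι : Type*} [Fintype ι] (P : MvPolynomial ι ℝ) (n : WithTop ℕ∞) :
    ContDiff ℝ n (fun z : ι → ℝ => eval z P) :=
  (AnalyticOnNhd.eval_mvPolynomial P).contDiff

end MvPolynomial

/-! ### Regular functions -/

namespace RealAlgVariety

section Regular

variable {ι : Type} {X : RealAlgVariety ι}

theorem isRegularOn_eval (U : Set X) (P : MvPolynomial ι ℝ) :
    X.IsRegularOn U (fun x => MvPolynomial.eval x.1 P) :=
  ⟨P, 1, fun x _ => by simp⟩

theorem IsRegularOn.add {U : Set X} {φ ψ : X → ℝ} (hφ : X.IsRegularOn U φ)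
    (hψ : X.IsRegularOn U ψ) : X.IsRegularOn U (fun x => φ x + ψ x) := by
  obtain ⟨P, Q, h⟩ := hφ
  obtain ⟨P', Q', h'⟩ := hψ
  refine ⟨P * Q' + Q * P', Q * Q', fun x hx => ?_⟩
  obtain ⟨h1, h2⟩ := h x hx
  obtain ⟨h3, h4⟩ := h' x hx
  refine ⟨by simpa using ⟨h1, h3⟩, ?_⟩
  simp only [h2, h4]
  rw [div_add_div _ _ h1 h3]
  simp

theorem IsRegularOn.mul {U : Set X} {φ ψ : X → ℝ} (hφ : X.IsRegularOn U φ)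
    (hψ : X.IsRegularOn U ψ) : X.IsRegularOn U (fun x => φ x * ψ x) := by
  obtain ⟨P, Q, h⟩ := hφ
  obtain ⟨P', Q', h'⟩ := hψ
  refine ⟨P * P', Q * Q', fun x hx => ?_⟩
  obtain ⟨h1, h2⟩ := h x hx
  obtain ⟨h3, h4⟩ := h' x hx
  refine ⟨by simpa using ⟨h1, h3⟩, ?_⟩
  simp only [h2, h4]
  rw [div_mul_div_comm]
  simp

theorem IsRegularOn.div {U : Set X} {φ ψ : X → ℝ} (hφ : X.IsRegularOn U φ)
    (hψ : X.IsRegularOn U ψ) (h0 : ∀ x ∈ U, ψ x ≠ 0) :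
    X.IsRegularOn U (fun x => φ x / ψ x) := by
  obtain ⟨P, Q, h⟩ := hφ
  obtain ⟨P', Q', h'⟩ := hψ
  refine ⟨P * Q', Q * P', fun x hx => ?_⟩
  obtain ⟨h1, h2⟩ := h x hx
  obtain ⟨h3, h4⟩ := h' x hx
  have h5 : MvPolynomial.eval x.1 P' ≠ 0 := fun h => h0 x hx (by simp [h4, h])
  refine ⟨by simpa using ⟨h1, h5⟩, ?_⟩
  simp only [h2, h4]
  rw [div_div_div_eq]
  simp

theorem IsRegularOn.sum {α : Type*} {U : Set X} {φ : α → X → ℝ} (s : Finset α)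
    (h : ∀ a ∈ s, X.IsRegularOn U (φ a)) : X.IsRegularOn U (fun x => ∑ a ∈ s, φ a x) := by
  classical
  induction s using Finset.induction_on with
  | empty => simpa using isRegularOn_eval U (0 : MvPolynomial ι ℝ)
  | insert a s ha ih =>
    simp only [Finset.sum_insert ha]
    exact (h a (Finset.mem_insert_self a s)).add
      (ih fun b hb => h b (Finset.mem_insert_of_mem hb))

theorem IsRegularOn.eval_comp {κ : Type*} {U : Set X} {g : X → κ → ℝ}
    (hg : ∀ k, X.IsRegularOn U (fun x => g x k)) (P : MvPolynomial κ ℝ) :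
    X.IsRegularOn U (fun x => MvPolynomial.eval (g x) P) := by
  induction P using MvPolynomial.induction_on with
  | C a => simpa using isRegularOn_eval U (MvPolynomial.C a)
  | add p q hp hq => simpa using hp.add hq
  | mul_X p j hp => simpa using hp.mul (hg j)

end Regular

/-! ### Approximate tangency of secants -/

/-- Differences of points of `Y` that are close to `y` are tangent to `Y` at `y` up to a small
relative error. This holds for linear maps because, the cotangent space being finite-dimensional,
every linear form which vanishes on `T_y Y` is the differential at `y` of a single polynomial that
vanishes on `Y`. -/
theorem eventually_norm_map_sub_le {ι κ : Type} [Fintype ι] [Fintype κ] {Y : RealAlgVariety ι}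
    (y : Y) (R : (ι → ℝ) →L[ℝ] (κ → ℝ)) (hR : ∀ v ∈ Y.tangentSpace y, R v = 0) {ε : ℝ}
    (hε : 0 < ε) :
    ∀ᶠ p : Y × Y in 𝓝 (y, y), ‖R (p.2.1 - p.1.1)‖ ≤ ε * ‖p.2.1 - p.1.1‖ := by
  classical
  let dP (P : MvPolynomial ι ℝ) : Module.Dual ℝ (ι → ℝ) :=
    ∑ i, MvPolynomial.eval y.1 (MvPolynomial.pderiv i P) • LinearMap.proj i
  -- The differentials at `y` of the polynomials vanishing on `Y`; `T_y Y` is the annihilator of `Λ`.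
  let Λ : Submodule ℝ (Module.Dual ℝ (ι → ℝ)) :=
    { carrier := {l | ∃ P : MvPolynomial ι ℝ, (∀ x : Y, MvPolynomial.eval x.1 P = 0) ∧ l = dP P}
      zero_mem' := ⟨0, by simp, by simp [dP]⟩
      add_mem' := by
        rintro _ _ ⟨P, hP, rfl⟩ ⟨Q, hQ, rfl⟩
        exact ⟨P + Q, fun x => by simp [hP, hQ], by
          simp [dP, add_smul, Finset.sum_add_distrib]⟩
      smul_mem' := by
        rintro c _ ⟨P, hP, rfl⟩
        exact ⟨MvPolynomial.C c * P, fun x => by simp [hP], by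
          simp [dP, Derivation.leibniz, Finset.smul_sum, mul_smul]⟩ }
  have hΛ : ∀ l : Module.Dual ℝ (ι → ℝ), (∀ v ∈ Y.tangentSpace y, l v = 0) → l ∈ Λ := by
    intro l hl
    rw [← Subspace.dualCoannihilator_dualAnnihilator_eq (W := Λ), Submodule.mem_dualAnnihilator]
    intro w hw
    rw [Submodule.mem_dualCoannihilator] at hw
    refine hl w fun P hP => ?_
    simpa [dP] using hw (dP P) ⟨P, hP, rfl⟩
  have key : ∀ k : κ, ∀ᶠ p : Y × Y in 𝓝 (y, y),
      |R (p.2.1 - p.1.1) k| ≤ ε * ‖p.2.1 - p.1.1‖ := by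
    intro k
    obtain ⟨P, hP, hPk⟩ := hΛ ((LinearMap.proj k).comp R.toLinearMap) (fun v hv => by
      simp [hR v hv])
    have hs := (MvPolynomial.hasStrictFDerivAt_eval P y.1).isLittleO.def hε
    have ht : Tendsto (fun p : Y × Y => (p.2.1, p.1.1)) (𝓝 (y, y)) (𝓝 (y.1, y.1)) := by
      have : Continuous (fun p : Y × Y => (p.2.1, p.1.1)) := by fun_prop
      exact this.tendsto (y, y)
    filter_upwards [ht.eventually hs] with p hp
    have h2 := LinearMap.congr_fun hPk (p.2.1 - p.1.1)
    simp only [LinearMap.comp_apply, LinearMap.proj_apply, ContinuousLinearMap.coe_coe] at h2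
    rw [h2]
    simpa [hP, dP] using hp
  filter_upwards [eventually_all.2 key] with p hp
  exact (pi_norm_le_iff_of_nonneg (by positivity)).2 hp

end RealAlgVariety

/-! ### Regular maps -/

/-- A regular map is the restriction of a rational map of the ambient spaces, which is smooth near
the points of the source (the junk value `0` of `P / Q` where `Q` vanishes is harmless). -/
theorem RegularMap.exists_extension {ι κ : Type} [Fintype ι] [Fintype κ] {X : RealAlgVariety ι}
    {Y : RealAlgVariety κ} (s : RegularMap X Y) :
    ∃ F : (ι → ℝ) → (κ → ℝ), (∀ x : X, F x.1 = (s.toFun x).1) ∧ ∀ x : X, ContDiffAt ℝ ∞ F x.1 := by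
  choose P Q h using s.isRegular
  refine ⟨fun z j => MvPolynomial.eval z (P j) / MvPolynomial.eval z (Q j), fun x => ?_,
    fun x => ?_⟩
  · ext j
    exact (h j x trivial).2.symm
  · refine contDiffAt_pi.2 fun j => ?_
    exact ((P j).contDiff_eval ∞).contDiffAt.div ((Q j).contDiff_eval ∞).contDiffAt
      (h j x trivial).1

theorem RegularMap.exists_comp {ι κ μ : Type} {X : RealAlgVariety ι} {Y : RealAlgVariety κ}
    {Z : RealAlgVariety μ} (s : RegularMap Y Z) (g : X → Y)
    (hg : ∀ k, X.IsRegularOn Set.univ (fun x => (g x).1 k)) :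
    ∃ g' : RegularMap X Z, ∀ x, g'.toFun x = s.toFun (g x) := by
  refine ⟨⟨fun x => s.toFun (g x), fun j => ?_⟩, fun x => rfl⟩
  obtain ⟨P, Q, h⟩ := s.isRegular j
  have he : (fun x : X => (s.toFun (g x)).1 j)
      = fun x : X => MvPolynomial.eval (g x).1 P / MvPolynomial.eval (g x).1 Q :=
    funext fun x => (h (g x) trivial).2
  rw [he]
  exact (RealAlgVariety.IsRegularOn.eval_comp hg P).div
    (RealAlgVariety.IsRegularOn.eval_comp hg Q) fun x _ => (h (g x) trivial).1

/-! ### Polynomial sections of algebraic vector bundles -/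

namespace AlgVectorBundle

/-- The fibers of an algebraic vector bundle are spanned by the values of its polynomial sections:
a local regular section becomes polynomial, and extends by zero, when multiplied by its
denominators and by a polynomial vanishing outside its domain. -/
theorem exists_polynomial_section {ι : Type} {Y : RealAlgVariety ι} (E : AlgVectorBundle Y)
    (𝒮 : Submodule (MvPolynomial ι ℝ) (Fin E.N → MvPolynomial ι ℝ))
    (h𝒮 : ∀ σ, (∀ y : Y, (fun i => MvPolynomial.eval y.1 (σ i)) ∈ E.fiber y) → σ ∈ 𝒮) (y₀ : Y) :
    E.fiber y₀ ≤ Submodule.span ℝ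
      ((fun (σ : Fin E.N → MvPolynomial ι ℝ) i => MvPolynomial.eval y₀.1 (σ i)) '' 𝒮) := by
  classical
  obtain ⟨U, ⟨S, hS⟩, hy₀, k, e, he, hspan⟩ := E.locallyTrivial y₀
  obtain ⟨A, hAS, hA⟩ : ∃ P ∈ S, MvPolynomial.eval y₀.1 P ≠ 0 := by rwa [hS] at hy₀
  rw [← (hspan y₀ hy₀).2, Submodule.span_le]
  rintro _ ⟨j, rfl⟩
  choose P Q hPQ using he j
  let σ : Fin E.N → MvPolynomial ι ℝ := fun i => A * (P i * ∏ l ∈ Finset.univ.erase i, Q l)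
  let d : Y → ℝ := fun y => MvPolynomial.eval y.1 A * ∏ l, MvPolynomial.eval y.1 (Q l)
  have hσ : ∀ y ∈ U, (fun i => MvPolynomial.eval y.1 (σ i)) = d y • e j y := by
    intro y hy
    ext i
    obtain ⟨h1, h2⟩ := hPQ i y hy
    simp only [σ, d, map_mul, map_prod, Pi.smul_apply, smul_eq_mul, h2,
      ← Finset.mul_prod_erase _ _ (Finset.mem_univ i)]
    field_simp
  have hd : d y₀ ≠ 0 := mul_ne_zero hA (Finset.prod_ne_zero_iff.2 fun i _ => (hPQ i y₀ hy₀).1)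
  have hmem : σ ∈ 𝒮 := by
    refine h𝒮 σ fun y => ?_
    by_cases hy : MvPolynomial.eval y.1 A = 0
    · have : (fun i => MvPolynomial.eval y.1 (σ i)) = 0 := by
        ext i
        simp [σ, hy]
      rw [this]
      exact Submodule.zero_mem _
    · have hyU : y ∈ U := by
        rw [hS]
        exact ⟨A, hAS, hy⟩
      rw [hσ y hyU, ← (hspan y hyU).2]
      exact Submodule.smul_mem _ _ (Submodule.subset_span ⟨j, rfl⟩)
  have hej : e j y₀ = (d y₀)⁻¹ • fun i => MvPolynomial.eval y₀.1 (σ i) := by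
    rw [hσ y₀ hy₀, smul_smul, inv_mul_cancel₀ hd, one_smul]
  simp only [hej]
  exact Submodule.smul_mem _ _ (Submodule.subset_span ⟨σ, hmem, rfl⟩)

/-- The linear map `ℝ^r → ℝ^N` whose columns are the values at `y` of `r` polynomial vectors. -/
noncomputable def frameMap {ι : Type} {N r : ℕ} (σ : Fin r → Fin N → MvPolynomial ι ℝ)
    (y : ι → ℝ) : (Fin r → ℝ) →L[ℝ] (Fin N → ℝ) :=
  LinearMap.toContinuousLinearMap
    (Fintype.linearCombination ℝ fun l i => MvPolynomial.eval y (σ l i))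

theorem frameMap_apply {ι : Type} {N r : ℕ} (σ : Fin r → Fin N → MvPolynomial ι ℝ)
    (y : ι → ℝ) (c : Fin r → ℝ) (i : Fin N) :
    frameMap σ y c i = ∑ l, c l * MvPolynomial.eval y (σ l i) := by
  simp [frameMap, Fintype.linearCombination_apply]

theorem continuous_frameMap {ι : Type} {N r : ℕ} (σ : Fin r → Fin N → MvPolynomial ι ℝ) :
    Continuous (frameMap σ) := by
  refine continuous_clm_apply.2 fun c => continuous_pi fun i => ?_
  simp only [frameMap_apply]
  exact continuous_finsetSum _ fun l _ => continuous_const.mul (MvPolynomial.continuous_eval _)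

/-- An algebraic vector bundle is generated by finitely many polynomial sections, as the module of
polynomial sections is Noetherian. So it is a quotient of a trivial bundle. -/
theorem exists_frameMap {ι : Type} [Finite ι] {Y : RealAlgVariety ι} (E : AlgVectorBundle Y) :
    ∃ (r : ℕ) (σ : Fin r → Fin E.N → MvPolynomial ι ℝ),
      ∀ y : Y, LinearMap.range (frameMap σ y.1).toLinearMap = E.fiber y := by
  let 𝒮 : Submodule (MvPolynomial ι ℝ) (Fin E.N → MvPolynomial ι ℝ) :=
    { carrier := {σ | ∀ y : Y, (fun i => MvPolynomial.eval y.1 (σ i)) ∈ E.fiber y}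
      zero_mem' := fun y => by
        convert (E.fiber y).zero_mem
        simp
      add_mem' := fun {a b} ha hb y => by
        convert (E.fiber y).add_mem (ha y) (hb y) using 1
        ext i
        simp
      smul_mem' := fun P a ha y => by
        convert (E.fiber y).smul_mem (MvPolynomial.eval y.1 P) (ha y) using 1
        ext i
        simp }
  obtain ⟨r, σ, hσ⟩ := Submodule.fg_iff_exists_fin_generating_family.1 (IsNoetherian.noetherian 𝒮)
  have hmem : ∀ l, σ l ∈ 𝒮 := fun l => hσ ▸ Submodule.subset_span ⟨l, rfl⟩
  refine ⟨r, σ, fun y => ?_⟩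
  have hr : LinearMap.range (frameMap σ y.1).toLinearMap
      = Submodule.span ℝ (Set.range fun l i => MvPolynomial.eval y.1 (σ l i)) :=
    Fintype.range_linearCombination ℝ _
  rw [hr]
  refine le_antisymm (Submodule.span_le.2 ?_) ?_
  · rintro _ ⟨l, rfl⟩
    exact hmem l y
  · refine (E.exists_polynomial_section 𝒮 (fun _ h => h) y).trans (Submodule.span_le.2 ?_)
    rintro _ ⟨a, ha, rfl⟩
    have ha' : a ∈ Submodule.span (MvPolynomial ι ℝ) (Set.range σ) := hσ ▸ ha
    refine Submodule.span_induction (p := fun a _ => (fun i => MvPolynomial.eval y.1 (a i)) ∈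
      Submodule.span ℝ (Set.range fun l i => MvPolynomial.eval y.1 (σ l i))) ?_ ?_ ?_ ?_ ha'
    · rintro _ ⟨l, rfl⟩
      exact Submodule.subset_span ⟨l, rfl⟩
    · convert Submodule.zero_mem _
      simp
    · intro a b _ _ iha ihb
      convert Submodule.add_mem _ iha ihb using 1
      ext i
      simp
    · intro P a _ iha
      convert Submodule.smul_mem _ (MvPolynomial.eval y.1 P) iha using 1
      ext i
      simp

end AlgVectorBundle

/-! ### Linearization of a dominating quasi-spray -/

namespace RealAlgVariety

theorem IsSmooth.continuous {ι κ : Type} [Fintype ι] [Fintype κ] {Y : RealAlgVariety ι} {V : Set Y}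
    {g : V → (κ → ℝ)} (hg : IsSmooth V g) : Continuous g := by
  refine continuous_iff_continuousAt.2 fun y => ?_
  obtain ⟨O, G, hO, hy, hG, h⟩ := hg y
  have hc : Continuous fun z : V => z.1.1 := by fun_prop
  have h1 : ContinuousAt (fun z : V => G z.1.1) y :=
    ContinuousAt.comp (f := fun z : V => z.1.1) (hG.continuousOn.continuousAt (hO.mem_nhds hy))
      hc.continuousAt
  refine h1.congr ?_
  filter_upwards [hc.continuousAt (hO.mem_nhds hy)] with z hz
  exact h z hz

end RealAlgVariety

namespace QuasiSpray

variable {ι : Type} [Fintype ι] {Y : RealAlgVariety ι} (q : QuasiSpray Y)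

theorem continuous_τ (V : Y.RelCompactOpen) :
    Continuous fun y : V.1 => (q.τ V y : Fin q.E.N → ℝ) := by
  refine continuous_pi fun i => ?_
  exact (continuous_apply (Sum.inr i)).comp (q.smooth_τ V).continuous

/-- The derivatives `A y` of the maps `v ↦ s V (τ V y + v)` at `0`, extended to the ambient space of
the fibers. They depend continuously on `y`, and they are uniform linear approximations; all this
comes from the strict differentiability of a rational extension of `s V`. -/
theorem exists_linearization (hq : q.IsDominating) (V : Y.RelCompactOpen) :
    ∃ A : V.1 → (Fin q.E.N → ℝ) →L[ℝ] (ι → ℝ), Continuous A ∧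
      (∀ y : V.1, (q.E.fiber y.1).map (A y).toLinearMap = Y.tangentSpace y.1) ∧
      ∀ y₀ : V.1, ∀ ε > 0, ∃ U ∈ 𝓝 y₀, ∃ r > 0, ∀ y ∈ U, ∀ w : q.E.fiber y.1, ‖w.1‖ < r →
        ‖((q.s V).toFun (q.E.point y.1 (w + q.τ V y))).1 - y.1.1 - A y w.1‖ ≤ ε * ‖w.1‖ := by
  obtain ⟨F, hF, hFs⟩ := (q.s V).exists_extension
  let J : (Fin q.E.N → ℝ) →L[ℝ] (ι ⊕ Fin q.E.N → ℝ) :=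
    ContinuousLinearMap.pi (Sum.elim (fun _ => 0) fun i => ContinuousLinearMap.proj i)
  have hJ : ∀ (y : Y) (v w : q.E.fiber y), (q.E.point y (w + v)).1 = (q.E.point y v).1 + J w.1 := by
    intro y v w
    ext (i | i) <;> simp [AlgVectorBundle.point, J, add_comm]
  have hJn : ∀ w, ‖J w‖ ≤ ‖w‖ := by
    intro w
    refine (pi_norm_le_iff_of_nonneg (norm_nonneg _)).2 ?_
    rintro (i | i)
    · simp [J]
    · simpa [J] using norm_le_pi_norm w i
  let b : V.1 → (ι ⊕ Fin q.E.N → ℝ) := fun y => (q.E.point y.1 (q.τ V y)).1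
  have hb : Continuous b := (q.smooth_τ V).continuous
  let A : V.1 → (Fin q.E.N → ℝ) →L[ℝ] (ι → ℝ) := fun y => (fderiv ℝ F (b y)).comp J
  have hA : Continuous A := by
    refine continuous_iff_continuousAt.2 fun y => ?_
    have h1 : ContinuousAt (fderiv ℝ F) (b y) :=
      ((hFs (q.E.point y.1 (q.τ V y))).fderiv_right (m := 0) (by simp)).continuousAt
    have h2 : ContinuousAt (fun y => fderiv ℝ F (b y)) y :=
      ContinuousAt.comp (f := b) h1 hb.continuousAt
    exact h2.clm_comp continuousAt_const
  refine ⟨A, hA, fun y => ?_, fun y₀ ε hε => ?_⟩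
  · obtain ⟨L, hL, hrange⟩ := hq V y
    have hd : DifferentiableAt ℝ F (b y) :=
      (hFs (q.E.point y.1 (q.τ V y))).differentiableAt (by simp)
    let T : q.E.fiber y.1 →L[ℝ] (ι ⊕ Fin q.E.N → ℝ) := J.comp (q.E.fiber y.1).subtypeL
    have h1 : HasFDerivAt (fun v : q.E.fiber y.1 => b y + T v) T 0 :=
      T.hasFDerivAt.const_add (b y)
    have h2 : HasFDerivAt (fun v : q.E.fiber y.1 => F (b y + T v)) ((fderiv ℝ F (b y)).comp T) 0 := by
      refine HasFDerivAt.comp (g := F) 0 ?_ h1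
      simpa using hd.hasFDerivAt
    have h3 : L = (fderiv ℝ F (b y)).comp T := by
      refine hL.unique (h2.congr_of_eventuallyEq (.of_forall fun v => ?_))
      change _ = F (b y + J v.1)
      rw [← hJ, hF]
    rw [← hrange, h3]
    ext v
    simp only [Submodule.mem_map, LinearMap.mem_range]
    constructor
    · rintro ⟨w, hw, rfl⟩
      exact ⟨⟨w, hw⟩, rfl⟩
    · rintro ⟨w, rfl⟩
      exact ⟨w.1, w.2, rfl⟩
  · have hs : HasStrictFDerivAt F (fderiv ℝ F (b y₀)) (b y₀) :=
      (hFs (q.E.point y₀.1 (q.τ V y₀))).hasStrictFDerivAt (by simp)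
    have h1 := hs.isLittleO.def (half_pos hε)
    obtain ⟨ρ, hρ, h2⟩ := Metric.eventually_nhds_iff.1 h1
    have h3 : ∀ᶠ y in 𝓝 y₀, dist (b y) (b y₀) < ρ / 2 :=
      hb.continuousAt.eventually (Metric.ball_mem_nhds _ (half_pos hρ))
    have h4 : ∀ᶠ y in 𝓝 y₀, dist (A y) (A y₀) < ε / 2 :=
      hA.continuousAt.eventually (Metric.ball_mem_nhds _ (half_pos hε))
    refine ⟨_, h3.and h4, ρ / 2, half_pos hρ, ?_⟩
    rintro y ⟨hy1, hy2⟩ w hw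
    have h5 := @h2 (b y + J w.1, b y) (by
      rw [Prod.dist_eq]
      refine max_lt ?_ (by linarith)
      calc dist (b y + J w.1) (b y₀) ≤ dist (b y + J w.1) (b y) + dist (b y) (b y₀) :=
            dist_triangle _ _ _
        _ < ρ := by
            rw [dist_self_add_left]
            linarith [hJn w.1])
    have h6 : F (b y) = y.1.1 := by rw [hF, q.s_τ]
    simp only [add_sub_cancel_left, h6] at h5
    have h7 : F (b y + J w.1) = ((q.s V).toFun (q.E.point y.1 (w + q.τ V y))).1 := by
      rw [← hJ, hF]
    rw [h7] at h5
    have h8 : ‖(A y₀ - A y) w.1‖ ≤ ε / 2 * ‖w.1‖ := by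
      refine (ContinuousLinearMap.le_opNorm _ _).trans ?_
      rw [← dist_eq_norm, dist_comm]
      gcongr
    calc _ = ‖(((q.s V).toFun (q.E.point y.1 (w + q.τ V y))).1 - y.1.1 - fderiv ℝ F (b y₀) (J w.1))
          + (A y₀ - A y) w.1‖ := by
            congr 1
            simp [A]
      _ ≤ ε / 2 * ‖J w.1‖ + ε / 2 * ‖w.1‖ := (norm_add_le _ _).trans (add_le_add h5 h8)
      _ ≤ ε / 2 * ‖w.1‖ + ε / 2 * ‖w.1‖ := by
            gcongr
            exact hJn w.1
      _ = ε * ‖w.1‖ := by ring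

/-- For `y` in a compact set, the equations `A y w = z - y` for `z ∈ Y` close to `y` can be solved for
`w ∈ E_y` with a bound on `w`, up to a small relative error. The error comes from `z - y` being only
almost tangent to `Y` at `y`. -/
theorem exists_approx_rightInverse (V : Y.RelCompactOpen)
    {A : V.1 → (Fin q.E.N → ℝ) →L[ℝ] (ι → ℝ)} (hA : Continuous A)
    (hAT : ∀ y : V.1, (q.E.fiber y.1).map (A y).toLinearMap = Y.tangentSpace y.1)
    {C : Set V.1} (hC : IsCompact C) :
    ∃ M > 0, ∃ δ > 0, ∀ y ∈ C, ∀ z : Y, dist z y.1 < δ → ∃ w : q.E.fiber y.1,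
      ‖w.1‖ ≤ M * dist z y.1 ∧ ‖A y w.1 - (z.1 - y.1.1)‖ ≤ 1 / 8 * dist z y.1 := by
  obtain ⟨r, σ, hσ⟩ := q.E.exists_frameMap
  refine hC.induction_on (p := fun S => ∃ M > 0, ∃ δ > 0, ∀ y ∈ S, ∀ z : Y, dist z y.1 < δ →
    ∃ w : q.E.fiber y.1, ‖w.1‖ ≤ M * dist z y.1 ∧
      ‖A y w.1 - (z.1 - y.1.1)‖ ≤ 1 / 8 * dist z y.1) ?_ ?_ ?_ ?_
  · exact ⟨1, one_pos, 1, one_pos, by simp⟩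
  · rintro S S' hS ⟨M, hM, δ, hδ, h⟩
    exact ⟨M, hM, δ, hδ, fun y hy => h y (hS hy)⟩
  · rintro S S' ⟨M, hM, δ, hδ, h⟩ ⟨M', hM', δ', hδ', h'⟩
    refine ⟨max M M', lt_max_of_lt_left hM, min δ δ', lt_min hδ hδ', ?_⟩
    rintro y (hy | hy) z hz
    · obtain ⟨w, h1, h2⟩ := h y hy z (hz.trans_le (min_le_left _ _))
      exact ⟨w, h1.trans (by gcongr; exact le_max_left _ _), h2⟩
    · obtain ⟨w, h1, h2⟩ := h' y hy z (hz.trans_le (min_le_right _ _))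
      exact ⟨w, h1.trans (by gcongr; exact le_max_right _ _), h2⟩
  intro y₀ _
  let S : V.1 → (Fin r → ℝ) →L[ℝ] (Fin q.E.N → ℝ) := fun y => AlgVectorBundle.frameMap σ y.1.1
  have hS : Continuous S := (AlgVectorBundle.continuous_frameMap σ).comp (by fun_prop)
  have hrange : LinearMap.range ((A y₀).comp (S y₀)).toLinearMap = Y.tangentSpace y₀.1 := by
    rw [← hAT, ← hσ]
    exact LinearMap.range_comp _ _
  obtain ⟨B, hB⟩ : ∃ B : (ι → ℝ) →ₗ[ℝ] (Fin r → ℝ),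
      ∀ v ∈ Y.tangentSpace y₀.1, A y₀ (S y₀ (B v)) = v := by
    obtain ⟨B₀, hB₀⟩ := LinearMap.exists_rightInverse_of_surjective
      ((A y₀).comp (S y₀)).toLinearMap.rangeRestrict (LinearMap.range_rangeRestrict _)
    obtain ⟨B, hB⟩ := LinearMap.exists_extend B₀
    refine ⟨B, fun v hv => ?_⟩
    have h1 := LinearMap.congr_fun hB₀ ⟨v, hrange ▸ hv⟩
    have h2 := LinearMap.congr_fun hB ⟨v, hrange ▸ hv⟩
    simp only [LinearMap.comp_apply, Submodule.subtype_apply] at h2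
    rw [h2]
    exact congrArg Subtype.val h1
  let W : V.1 → (ι → ℝ) →L[ℝ] (Fin q.E.N → ℝ) :=
    fun y => (S y).comp (LinearMap.toContinuousLinearMap B)
  have hW : Continuous W := hS.clm_comp continuous_const
  have hAW : Continuous fun y => (A y).comp (W y) := hA.clm_comp hW
  have e1 : ∀ᶠ y in 𝓝 y₀, ‖W y‖ < ‖W y₀‖ + 1 :=
    hW.norm.continuousAt.eventually (gt_mem_nhds (lt_add_one _))
  have e2 : ∀ᶠ y in 𝓝 y₀, dist ((A y).comp (W y)) ((A y₀).comp (W y₀)) < 1 / 16 :=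
    hAW.continuousAt.eventually (Metric.ball_mem_nhds _ (by norm_num))
  have e3 := RealAlgVariety.eventually_norm_map_sub_le y₀.1
    ((A y₀).comp (W y₀) - ContinuousLinearMap.id ℝ _)
    (fun v hv => by simpa [sub_eq_zero, W] using hB v hv) (ε := 1 / 16) (by norm_num)
  obtain ⟨ρ, hρ, h3⟩ := Metric.eventually_nhds_iff.1 e3
  have e4 : ∀ᶠ y in 𝓝 y₀, dist y.1 y₀.1 < ρ / 2 :=
    continuous_subtype_val.continuousAt.eventually (Metric.ball_mem_nhds _ (half_pos hρ))
  refine ⟨_, mem_nhdsWithin_of_mem_nhds (e1.and (e2.and e4)), ‖W y₀‖ + 1, by positivity, ρ / 2,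
    half_pos hρ, ?_⟩
  rintro y ⟨hy1, hy2, hy3⟩ z hz
  have hzy : dist z y.1 = ‖z.1 - y.1.1‖ := by rw [Subtype.dist_eq, dist_eq_norm]
  refine ⟨⟨W y (z.1 - y.1.1), ?_⟩, ?_, ?_⟩
  · rw [← hσ]
    exact ⟨_, rfl⟩
  · rw [hzy]
    exact (ContinuousLinearMap.le_opNorm _ _).trans (by gcongr)
  · have h5 := @h3 (y.1, z) (by
      rw [Prod.dist_eq]
      refine max_lt (by dsimp only; linarith) ?_
      exact (dist_triangle z y.1 y₀.1).trans_lt (by linarith))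
    have h6 : ‖((A y).comp (W y) - (A y₀).comp (W y₀)) (z.1 - y.1.1)‖
        ≤ 1 / 16 * ‖z.1 - y.1.1‖ := by
      refine (ContinuousLinearMap.le_opNorm _ _).trans ?_
      rw [← dist_eq_norm]
      gcongr
    rw [hzy]
    calc _ = ‖((A y).comp (W y) - (A y₀).comp (W y₀)) (z.1 - y.1.1)
          + ((A y₀).comp (W y₀) - ContinuousLinearMap.id ℝ (ι → ℝ)) (z.1 - y.1.1)‖ := by
            congr 1
            simp
      _ ≤ 1 / 16 * ‖z.1 - y.1.1‖ + 1 / 16 * ‖z.1 - y.1.1‖ :=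
            (norm_add_le _ _).trans (add_le_add h6 h5)
      _ = 1 / 8 * ‖z.1 - y.1.1‖ := by ring

/-- Local bounds on the linearization error hold uniformly on a compact set. -/
theorem exists_uniform_linearization (V : Y.RelCompactOpen)
    {A : V.1 → (Fin q.E.N → ℝ) →L[ℝ] (ι → ℝ)} {ε : ℝ}
    (hA : ∀ y₀ : V.1, ∃ U ∈ 𝓝 y₀, ∃ r > 0, ∀ y ∈ U, ∀ w : q.E.fiber y.1, ‖w.1‖ < r →
        ‖((q.s V).toFun (q.E.point y.1 (w + q.τ V y))).1 - y.1.1 - A y w.1‖ ≤ ε * ‖w.1‖)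
    {C : Set V.1} (hC : IsCompact C) :
    ∃ r > 0, ∀ y ∈ C, ∀ w : q.E.fiber y.1, ‖w.1‖ < r →
        ‖((q.s V).toFun (q.E.point y.1 (w + q.τ V y))).1 - y.1.1 - A y w.1‖ ≤ ε * ‖w.1‖ := by
  refine hC.induction_on (p := fun S => ∃ r > 0, ∀ y ∈ S, ∀ w : q.E.fiber y.1, ‖w.1‖ < r →
        ‖((q.s V).toFun (q.E.point y.1 (w + q.τ V y))).1 - y.1.1 - A y w.1‖ ≤ ε * ‖w.1‖) ?_ ?_ ?_ ?_
  · exact ⟨1, one_pos, by simp⟩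
  · rintro S S' hS ⟨r, hr, h⟩
    exact ⟨r, hr, fun y hy => h y (hS hy)⟩
  · rintro S S' ⟨r, hr, h⟩ ⟨r', hr', h'⟩
    refine ⟨min r r', lt_min hr hr', ?_⟩
    rintro y (hy | hy) w hw
    · exact h y hy w (hw.trans_le (min_le_left _ _))
    · exact h' y hy w (hw.trans_le (min_le_right _ _))
  · intro y₀ _
    obtain ⟨U, hU, h⟩ := hA y₀
    exact ⟨U, mem_nhdsWithin_of_mem_nhds hU, h⟩

end QuasiSpray

/-! ### Compactness and polynomial approximation -/

namespace RealAlgVariety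

theorem isClosed_carrier {ι : Type} (Y : RealAlgVariety ι) : IsClosed Y.carrier := by
  obtain ⟨S, hS⟩ := Y.isAlgebraic
  rw [hS, Set.ofPred_forall]
  refine isClosed_iInter fun P => ?_
  rw [Set.ofPred_forall]
  exact isClosed_iInter fun _ => isClosed_eq (MvPolynomial.continuous_eval P) continuous_const

theorem isCompact_setOf_norm_le {ι : Type} [Fintype ι] (Y : RealAlgVariety ι) (R : ℝ) :
    IsCompact {y : Y | ‖y.1‖ ≤ R} := by
  have h := Y.isClosed_carrier.isClosedEmbedding_subtypeVal.isCompact_preimage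
    (isCompact_closedBall (0 : ι → ℝ) R)
  convert h using 1
  ext y
  simp

theorem exists_polynomial_near {ι : Type} {X : RealAlgVariety ι} {Z : Type*} [TopologicalSpace Z]
    [CompactSpace Z] (j : C(Z, X)) (hj : Function.Injective j) (f : C(Z, ℝ)) {ε : ℝ} (hε : 0 < ε) :
    ∃ P : MvPolynomial ι ℝ, ∀ x, |MvPolynomial.eval (j x).1 P - f x| < ε := by
  let e : MvPolynomial ι ℝ →ₐ[ℝ] C(Z, ℝ) := MvPolynomial.aeval fun i =>
    ⟨fun x => (j x).1 i,
      (continuous_apply i).comp (continuous_subtype_val.comp j.continuous)⟩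
  have he : ∀ P x, e P x = MvPolynomial.eval (j x).1 P := by
    intro P x
    induction P using MvPolynomial.induction_on with
    | C a => simp [e]
    | add p q hp hq => simp [hp, hq]
    | mul_X p i hp =>
      rw [map_mul, ContinuousMap.mul_apply, hp]
      simp [e]
  obtain ⟨⟨_, P, rfl⟩, hP⟩ :=
    ContinuousMap.exists_mem_subalgebra_near_continuousMap_of_separatesPoints e.range (by
      intro x y hxy
      obtain ⟨i, hi⟩ := Function.ne_iff.1 fun h => hxy (hj (Subtype.ext h))
      exact ⟨_, ⟨e (MvPolynomial.X i), ⟨MvPolynomial.X i, rfl⟩, rfl⟩, by simpa [he] using hi⟩) f ε hε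
  refine ⟨P, fun x => ?_⟩
  rw [← he]
  exact (ContinuousMap.norm_lt_iff _ hε).1 hP x

theorem exists_polynomial_mem_of_isOpen {ι : Type} {X : RealAlgVariety ι} {Z : Type*}
    [TopologicalSpace Z] [CompactSpace Z] (j : C(Z, X)) (hj : Function.Injective j) {r : ℕ}
    {O : Set (Z × (Fin r → ℝ))} (hO : IsOpen O) (c : C(Z, Fin r → ℝ)) (hc : ∀ x, (x, c x) ∈ O) :
    ∃ P : Fin r → MvPolynomial ι ℝ, ∀ x, (x, fun l => MvPolynomial.eval (j x).1 (P l)) ∈ O := by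
  have hcont : Continuous fun c : C(Z, Fin r → ℝ) => (ContinuousMap.id Z).prodMk c :=
    ContinuousMap.continuous_of_continuous_uncurry _ (by
      change Continuous fun p : C(Z, Fin r → ℝ) × Z => (p.2, p.1 p.2)
      fun_prop)
  have hopen : IsOpen {c : C(Z, Fin r → ℝ) |
      Set.MapsTo ((ContinuousMap.id Z).prodMk c) Set.univ O} :=
    (ContinuousMap.isOpen_setOfPred_mapsTo isCompact_univ hO).preimage hcont
  obtain ⟨ε, hε, h⟩ := Metric.isOpen_iff.1 hopen c fun x _ => hc x
  choose P hP using fun l => exists_polynomial_near j hj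
    ((⟨fun v => v l, continuous_apply l⟩ : C(Fin r → ℝ, ℝ)).comp c) (half_pos hε)
  let c' : C(Z, Fin r → ℝ) := ⟨fun x l => MvPolynomial.eval (j x).1 (P l), by
    refine continuous_pi fun l => (MvPolynomial.continuous_eval (P l)).comp ?_
    fun_prop⟩
  refine ⟨P, fun x => @h c' ?_ x trivial⟩
  refine ((ContinuousMap.dist_le (half_pos hε).le).2 fun x => ?_).trans_lt (half_lt_self hε)
  exact (dist_pi_le_iff (half_pos hε).le).2 fun l => (hP l x).le

/-! ### Newton's method with regular maps -/

/-- One step of Newton's method. If a regular map `g` is uniformly close to `h` on the compact space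
`Z`, then moving `g` along the quasi-spray, in a direction which solves the linearized equation
approximately, yields a regular map twice as close to `h`. The approximate solutions form an open
convex set, so they can be chosen continuously, and then polynomially, in the coefficients with
respect to a finite family of polynomial sections that generates the bundle. -/
theorem IsQuasiMalleable.exists_newton_step {ι κ : Type} [Fintype κ]
    {X : RealAlgVariety ι} {Y : RealAlgVariety κ} (hY : Y.IsQuasiMalleable) {Z : Type*}
    [TopologicalSpace Z] [CompactSpace Z] [T2Space Z] (j : C(Z, X)) (hj : Function.Injective j)
    (R : ℝ) :
    ∃ δ > 0, ∀ (h : C(Z, Y)) (g : RegularMap X Y) (η : ℝ), (∀ x, ‖(h x).1‖ ≤ R) → 0 < η → η ≤ δ →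
      (∀ x, dist (h x) (g.toFun (j x)) ≤ η) →
      ∃ g' : RegularMap X Y, ∀ x, dist (h x) (g'.toFun (j x)) ≤ η / 2 := by
  obtain ⟨q, hq⟩ := hY
  -- `h` has values in the ball of radius `R`, so `g` has values in the compact subset `C` of `V`.
  let V : Y.RelCompactOpen := ⟨{y | ‖y.1‖ < R + 2},
    isOpen_lt (by fun_prop) continuous_const,
    (Y.isCompact_setOf_norm_le (R + 2)).of_isClosed_subset isClosed_closure
      (closure_minimal (fun y (hy : ‖y.1‖ < R + 2) => hy.le)
        (Y.isCompact_setOf_norm_le (R + 2)).isClosed)⟩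
  let C : Set V.1 := {y | ‖y.1.1‖ ≤ R + 1}
  have hC : IsCompact C := by
    rw [Subtype.isCompact_iff]
    convert Y.isCompact_setOf_norm_le (R + 1) using 1
    ext y
    constructor
    · rintro ⟨y, hy, rfl⟩
      exact hy
    · intro hy
      have hy' : ‖y.1‖ ≤ R + 1 := hy
      exact ⟨⟨y, show ‖y.1‖ < R + 2 by linarith⟩, hy, rfl⟩
  obtain ⟨A, hA, hAT, hAlin⟩ := q.exists_linearization hq V
  obtain ⟨M, hM, δ, hδ, hsol⟩ := q.exists_approx_rightInverse V hA hAT hC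
  -- The directions used below have norm less than `2 * M * η`, so that the linearization error is
  -- at most `η / 4`; the linearized equation contributes another `η / 4`.
  obtain ⟨ρ, hρ, hlin⟩ := q.exists_uniform_linearization V (A := A) (ε := 1 / (8 * M))
    (fun y₀ => hAlin y₀ _ (by positivity)) hC
  obtain ⟨r, σ, hσ⟩ := q.E.exists_frameMap
  refine ⟨min 1 (min (δ / 2) (ρ / (2 * M))), by positivity, fun h g η hh hη hηδ hgh => ?_⟩
  obtain ⟨hη1, hη2, hη3⟩ : η ≤ 1 ∧ η ≤ δ / 2 ∧ η ≤ ρ / (2 * M) :=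
    ⟨hηδ.trans (min_le_left _ _), (hηδ.trans (min_le_right _ _)).trans (min_le_left _ _),
      (hηδ.trans (min_le_right _ _)).trans (min_le_right _ _)⟩
  have hgC : ∀ x, ‖(g.toFun (j x)).1‖ ≤ R + 1 := by
    intro x
    have h1 : ‖(h x).1 - (g.toFun (j x)).1‖ ≤ η := by
      rw [← dist_eq_norm]
      exact hgh x
    have h2 := norm_sub_norm_le (g.toFun (j x)).1 (h x).1
    rw [norm_sub_rev] at h2
    linarith [hh x]
  have hgV : ∀ x, g.toFun (j x) ∈ V.1 := fun x =>
    show ‖(g.toFun (j x)).1‖ < R + 2 by linarith [hgC x]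
  let y : Z → V.1 := fun x => ⟨g.toFun (j x), hgV x⟩
  have hy : Continuous y := (g.continuous_toFun.comp j.continuous).subtype_mk _
  have hyC : ∀ x, y x ∈ C := hgC
  let S : Z → (Fin r → ℝ) →L[ℝ] (Fin q.E.N → ℝ) := fun x => AlgVectorBundle.frameMap σ (y x).1.1
  have hS : Continuous S := (AlgVectorBundle.continuous_frameMap σ).comp (by fun_prop)
  let t : Z → (Fin q.E.N → ℝ) := fun x => q.τ V (y x)
  have ht : Continuous t := (q.continuous_τ V).comp hy
  let v : Z → (κ → ℝ) := fun x => (h x).1 - (y x).1.1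
  have hv : Continuous v := by fun_prop
  have hvη : ∀ x, dist (h x) (y x).1 ≤ η := hgh
  -- The coefficient vectors that are good enough; the slack `η`, rather than `dist (h x) (g x)`,
  -- keeps this condition open also where `h` and `g` agree.
  let O : Set (Z × (Fin r → ℝ)) := {p | ‖S p.1 p.2 - t p.1‖ < 2 * M * η ∧
    ‖A (y p.1) (S p.1 p.2 - t p.1) - v p.1‖ < η / 4}
  have hW : Continuous fun p : Z × (Fin r → ℝ) => S p.1 p.2 - t p.1 := by fun_prop
  have hO : IsOpen O := by
    refine (isOpen_lt hW.norm continuous_const).inter (isOpen_lt (Continuous.norm ?_)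
      continuous_const)
    exact ((hA.comp (hy.comp continuous_fst)).clm_apply hW).sub (hv.comp continuous_fst)
  have hconv : ∀ x, Convex ℝ {c | (x, c) ∈ O} := by
    intro x
    have h1 : Convex ℝ (S x ⁻¹' Metric.ball (t x) (2 * M * η)) :=
      (convex_ball _ _).linear_preimage (S x).toLinearMap
    have h2 : Convex ℝ ((A (y x)).comp (S x) ⁻¹' Metric.ball (A (y x) (t x) + v x) (η / 4)) :=
      (convex_ball _ _).linear_preimage ((A (y x)).comp (S x)).toLinearMap
    convert h1.inter h2 using 1
    ext c
    simp [O, dist_eq_norm, sub_sub]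
  have hne : ∀ x, ∃ c, (x, c) ∈ O := by
    intro x
    obtain ⟨w, hw1, hw2⟩ := hsol (y x) (hyC x) (h x) (by linarith [hvη x])
    have hmem : w.1 + t x ∈ LinearMap.range (S x).toLinearMap := by
      rw [hσ]
      exact (w + q.τ V (y x)).2
    obtain ⟨c, hc⟩ := hmem
    have hc' : S x c - t x = w.1 := sub_eq_of_eq_add hc
    refine ⟨c, ?_, ?_⟩
    · simp only [hc']
      have : M * dist (h x) (y x).1 ≤ M * η := by gcongr; exact hvη x
      have : 0 < M * η := by positivity
      linarith
    · simp only [hc']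
      exact hw2.trans_lt (by linarith [hvη x])
  obtain ⟨c, hc⟩ := exists_continuous_forall_mem_convex_of_local_const hconv fun x => by
    obtain ⟨c, hc⟩ := hne x
    have h1 : Continuous fun x' : Z => (x', c) := by fun_prop
    exact ⟨c, h1.continuousAt.eventually (hO.mem_nhds hc)⟩
  obtain ⟨P, hP⟩ := exists_polynomial_mem_of_isOpen j hj hO c hc
  let a : X → (Fin r → ℝ) := fun x l => MvPolynomial.eval x.1 (P l)
  let ξ : (x : X) → q.E.fiber (g.toFun x) := fun x =>
    ⟨AlgVectorBundle.frameMap σ (g.toFun x).1 (a x), by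
      rw [← hσ]
      exact ⟨_, rfl⟩⟩
  obtain ⟨g', hg'⟩ := (q.s V).exists_comp (fun x : X => q.E.point (g.toFun x) (ξ x)) (by
    rintro (k | i)
    · exact g.isRegular k
    · change X.IsRegularOn Set.univ fun x => AlgVectorBundle.frameMap σ (g.toFun x).1 (a x) i
      simp only [AlgVectorBundle.frameMap_apply]
      exact IsRegularOn.sum _ fun l _ =>
        (isRegularOn_eval _ (P l)).mul (IsRegularOn.eval_comp g.isRegular _))
  refine ⟨g', fun x => ?_⟩
  obtain ⟨h1, h2⟩ : ‖S x (a (j x)) - t x‖ < 2 * M * η ∧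
    ‖A (y x) (S x (a (j x)) - t x) - v x‖ < η / 4 := hP x
  let w : q.E.fiber (y x).1 := ξ (j x) - q.τ V (y x)
  have hw : w.1 = S x (a (j x)) - t x := rfl
  have h3 := hlin (y x) (hyC x) w (by
    rw [hw]
    refine h1.trans_le ?_
    rw [le_div_iff₀ (by positivity)] at hη3
    linarith)
  have h4 : (g'.toFun (j x)) = (q.s V).toFun (q.E.point (y x).1 (w + q.τ V (y x))) := by
    rw [hg', sub_add_cancel]
  rw [← h4, hw] at h3
  have h5 : 1 / (8 * M) * ‖S x (a (j x)) - t x‖ ≤ η / 4 := by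
    calc _ ≤ 1 / (8 * M) * (2 * M * η) := by gcongr
      _ = η / 4 := by field_simp; norm_num
  rw [dist_comm, Subtype.dist_eq, dist_eq_norm]
  calc _ = ‖((g'.toFun (j x)).1 - (y x).1.1 - A (y x) (S x (a (j x)) - t x))
        + (A (y x) (S x (a (j x)) - t x) - v x)‖ := by
          congr 1
          simp [v]
    _ ≤ η / 4 + η / 4 := (norm_add_le _ _).trans (add_le_add (h3.trans h5) h2.le)
    _ = η / 2 := by ring

/-- Iterating the Newton step: a continuous map from `Z` that is close enough to a regular map is a
uniform limit of regular maps. How close depends only on a bound for its values. -/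
theorem IsQuasiMalleable.exists_mem_closure_range {ι κ : Type} [Fintype κ]
    {X : RealAlgVariety ι} {Y : RealAlgVariety κ} (hY : Y.IsQuasiMalleable) {Z : Type*}
    [TopologicalSpace Z] [CompactSpace Z] [T2Space Z] (j : C(Z, X)) (hj : Function.Injective j)
    (R : ℝ) :
    ∃ δ > 0, ∀ (h : C(Z, Y)) (g : RegularMap X Y), (∀ x, ‖(h x).1‖ ≤ R) →
      dist h (g.toContinuousMap.comp j) ≤ δ →
      h ∈ closure (Set.range fun g : RegularMap X Y => g.toContinuousMap.comp j) := by
  obtain ⟨δ, hδ, hstep⟩ := hY.exists_newton_step j hj R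
  refine ⟨δ, hδ, fun h g hh hg => ?_⟩
  have hk : ∀ k : ℕ, ∃ g : RegularMap X Y, ∀ x, dist (h x) (g.toFun (j x)) ≤ δ * (1 / 2) ^ k := by
    intro k
    induction k with
    | zero => exact ⟨g, fun x => by
      simpa using! (ContinuousMap.dist_le hδ.le).1 hg x⟩
    | succ k ih =>
      obtain ⟨g, hg⟩ := ih
      obtain ⟨g', hg'⟩ := hstep h g _ hh (by positivity)
        (mul_le_of_le_one_right hδ.le (pow_le_one₀ (by norm_num) (by norm_num))) hg
      exact ⟨g', fun x => (hg' x).trans_eq (by ring)⟩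
  have hlim : Tendsto (fun k : ℕ => δ * (1 / 2 : ℝ) ^ k) atTop (𝓝 0) := by
    simpa using (tendsto_pow_atTop_nhds_zero_of_lt_one (r := (1 / 2 : ℝ)) (by norm_num)
      (by norm_num)).const_mul δ
  refine Metric.mem_closure_iff.2 fun ε hε => ?_
  obtain ⟨k, hk'⟩ := (hlim.eventually (gt_mem_nhds hε)).exists
  obtain ⟨g, hg⟩ := hk k
  exact ⟨_, ⟨g, rfl⟩, ((ContinuousMap.dist_le (by positivity)).2 hg).trans_lt hk'⟩

/-- Along a path of continuous maps, being a uniform limit of regular maps is a closed condition,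
and it is an open one because the constant of `exists_mem_closure_range` is uniform on the path. -/
theorem IsQuasiMalleable.mem_closure_range_of_path {ι κ : Type} [Fintype κ]
    {X : RealAlgVariety ι} {Y : RealAlgVariety κ} (hY : Y.IsQuasiMalleable) {Z : Type*}
    [TopologicalSpace Z] [CompactSpace Z] [T2Space Z] (j : C(Z, X)) (hj : Function.Injective j)
    (γ : unitInterval → C(Z, Y)) (hγ : Continuous γ)
    (h0 : γ 0 ∈ closure (Set.range fun g : RegularMap X Y => g.toContinuousMap.comp j)) :
    γ 1 ∈ closure (Set.range fun g : RegularMap X Y => g.toContinuousMap.comp j) := by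
  obtain ⟨R, hR⟩ : ∃ R : ℝ, ∀ t x, ‖(γ t x).1‖ ≤ R := by
    have hc : Continuous fun p : unitInterval × Z => (γ p.1 p.2).1 := by fun_prop
    obtain ⟨R, hR⟩ := (isCompact_range hc).isBounded.exists_norm_le
    exact ⟨R, fun t x => hR _ ⟨(t, x), rfl⟩⟩
  obtain ⟨δ, hδ, hcl⟩ := hY.exists_mem_closure_range j hj R
  let T : Set unitInterval :=
    γ ⁻¹' closure (Set.range fun g : RegularMap X Y => g.toContinuousMap.comp j)
  have hT : IsClopen T := by
    refine ⟨isClosed_closure.preimage hγ, isOpen_iff_mem_nhds.2 fun t ht => ?_⟩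
    obtain ⟨_, ⟨g, rfl⟩, hg⟩ := Metric.mem_closure_iff.1 ht (δ / 2) (half_pos hδ)
    filter_upwards [hγ.continuousAt (Metric.ball_mem_nhds (γ t) (half_pos hδ))] with s hs
    refine hcl (γ s) g (hR s) ((dist_triangle _ (γ t) _).trans ?_)
    have hs' : dist (γ s) (γ t) < δ / 2 := hs
    linarith
  have : T = Set.univ := hT.eq_univ ⟨0, h0⟩
  have h1 : (1 : unitInterval) ∈ T := this ▸ Set.mem_univ _
  exact h1

end RealAlgVariety

/-! ### Reduction to uniform approximation on compact sets -/

theorem theorem1p12 {m n : ℕ} (Y : RealAlgVariety (Fin n)) (hY : Y.IsNonsingular)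
    (hYq : Y.IsQuasiMalleable) (X : RealAlgVariety (Fin m)) (D : Set X) (f : C(D, Y))
    (hf : ∃ f₀ : RegularMap X Y, (f₀.toContinuousMap.restrict D).Homotopic f) :
    ApproximableByRegularMaps X Y D f := by
  obtain ⟨f₀, ⟨H⟩⟩ := hf
  intro 𝒰 h𝒰 hf𝒰
  obtain ⟨⟨K, ε⟩, ⟨hK, hε⟩, hsub⟩ :=
    (nhds_basis_uniformity' Metric.uniformity_basis_dist.compactConvergenceUniformity).mem_iff.1
      (h𝒰.mem_nhds hf𝒰)
  have : CompactSpace K := isCompact_iff_compactSpace.1 hK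
  let j : C(K, X) := ⟨fun x => x.1.1, by fun_prop⟩
  have hj : Function.Injective j := fun a b hab => Subtype.ext (Subtype.ext hab)
  let γ : unitInterval → C(K, Y) := fun t => (H.curry t).comp ⟨Subtype.val, by fun_prop⟩
  have hγ : Continuous γ := (ContinuousMap.continuous_precomp _).comp H.curry.continuous
  have h0 : γ 0 = f₀.toContinuousMap.comp j := by
    ext1 x
    exact H.apply_zero x.1
  have h1 := hYq.mem_closure_range_of_path j hj γ hγ (h0 ▸ subset_closure ⟨f₀, rfl⟩)
  obtain ⟨_, ⟨g, rfl⟩, hg⟩ := Metric.mem_closure_iff.1 h1 ε hε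
  refine ⟨g, hsub fun x hx => ?_⟩
  have h2 := (ContinuousMap.dist_lt_iff hε).1 hg ⟨x, hx⟩
  have h3 : γ 1 ⟨x, hx⟩ = f x := H.apply_one x
  rwa [h3] at h2
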